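/- **Model.** A network is a connected undirected graph on $n$ nodes with unique ids from $[n]$ and diameter $D$. Time is divided into synchronous rounds. There are $\mathcal C\ge 1$ channels; in each round every node picks one channel and either transmits or receives on it. A node receiving on channel $c$ gets a packet if exactly one of its neighbours transmits on $c$; it detects silence if none does, and a collision if at least two do (collision detection). A transmitting node learns nothing from the channel. In global broadcast a single source initially holds a message $m$; a node not yet holding $m$ is inactive, i.e. it can only listen, on the default channel $1$, and it becomes active only by receiving a packet that contains $m$ (detecting a collision does not suffice). Active nodes run an arbitrary randomized algorithm with independent private randomness; nodes may know $n$, $\mathcal C$, $D$, their own id and whether they are the source, but know nothing else about the topology in advance. The problem is solved once all nodes hold $m$. **Theorem.** There is an absolute constant $c>0$ such that the following holds for every randomized algorithm $\mathcal A$ in this model. 1. For all integers $\mathcal C\ge 1$, $D\ge 2$ and $n\ge D+1$ there are a network of size $n$ and diameter exactly $D$, which is moreover a unit disk graph, and a source in it, for which the expected number of rounds that $\mathcal A$ needs to solve global broadcast is at least $c\,D\log(n/D)$. 2. Consequently, if $\mathcal A$ solves global broadcast in $f(n,\mathcal C,D)$ rounds in expectation, for all $n$, $\mathcal C\ge 1$,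 $D\ge 2$, in every network of size $n$ and diameter $D$ and from every source, then $f(n,\mathcal C,D)\ge c\,D\log(n/D)$ for all $\mathcal C\ge 1$, $D\ge 2$, $n\ge D+1$; that is, $f(n,\mathcal C,D)\in\Omega(D\log(n/D))$. -/

import Mathlib

open MeasureTheory
open scoped ENNReal

universe u

namespace RadioNetwork

/-- The content of one transmission: whether the broadcast message `m` (treated as a token) is
part of it, together with an arbitrary finite bit string of further information. -/
structure Packet where
  hasMsg : Bool
  payload : List Bool

/-- In every round a node participates on one of the `C` channels, either receiving on it or
transmitting a packet on it. -/
inductive Action (C : ℕ) where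
  | listen (c : Fin C)
  | transmit (c : Fin C) (p : Packet)

/-- The packet that a node performing the given action sends on channel `c`, if any. -/
def Action.sentOn {C : ℕ} (c : Fin C) : Action C → Option Packet
  | .listen _ => none
  | .transmit c' p => if c' = c then some p else none

/-- What a node perceives in one round. A receiver distinguishes silence from collision (collision
detection); a transmitter perceives nothing of the channel. -/
inductive Observation where
  | sent
  | silence
  | collision
  | received (p : Packet)

/-- A randomized distributed algorithm for `n` nodes with ids in `Fin n` and `C` channels. Each
node owns a private random seed drawn from `seedLaw`, and chooses its action in each round as a
function of its id, of whether it is the source, of its seed, and of the list of its observations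
in all earlier rounds (most recent first). In particular it knows `n`, `C` and the round number,
but knows nothing about the network except through its observations. -/
structure Algorithm (n C : ℕ) where
  Seed : Type u
  [seedSpace : MeasurableSpace Seed]
  seedLaw : Measure Seed
  [seedProb : IsProbabilityMeasure seedLaw]
  act : Fin n → Bool → Seed → List Observation → Action C
  measurable_act : ∀ (v : Fin n) (b : Bool) (h : List Observation) (a : Action C),
    MeasurableSet {x : Seed | act v b x h = a}

attribute [instance] Algorithm.seedSpace Algorithm.seedProb

section Execution

variable {n C : ℕ}

open Classical in
/-- The packets sent on channel `c` by the neighbours of `v`, if node `u` performs `a u`. -/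
noncomputable def arriving (G : SimpleGraph (Fin n)) (a : Fin n → Action C) (v : Fin n)
    (c : Fin C) : List Packet :=
  ((List.finRange n).filter (fun u => G.Adj v u)).filterMap (fun u => (a u).sentOn c)

/-- What node `v` perceives in a round in which every node `u` performs the action `a u`:
a receiver on `c` gets a packet iff exactly one of its neighbours transmits on `c`. -/
noncomputable def observe (G : SimpleGraph (Fin n)) (a : Fin n → Action C) (v : Fin n) :
    Observation :=
  match a v with
  | .transmit _ _ => .sent
  | .listen c =>
    match arriving G a v c with
    | [] => .silence
    | [p] => .received p
    | _ :: _ :: _ => .collision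

/-- Node `v` with past observations `h` has the broadcast message (equivalently, is active):
it is the source, or it has received a packet that contains the message. -/
def HasMessage (source v : Fin n) (h : List Observation) : Prop :=
  v = source ∨ ∃ p : Packet, Observation.received p ∈ h ∧ p.hasMsg = true

namespace Algorithm

variable [NeZero C] (A : Algorithm n C)

open Classical in
/-- The action of node `v` after the observations `h`. Nodes without the broadcast message are
inactive: they listen on the default channel `0`. Active nodes follow the algorithm. -/
noncomputable def nodeAction (source v : Fin n) (x : A.Seed) (h : List Observation) : Action C :=
  if HasMessage source v h then A.act v (decide (v = source)) x h else .listen 0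

/-- The observations of all nodes during the first `r` rounds of the execution on the network `G`
in which node `v` has the random seed `ω v`. -/
noncomputable def history (G : SimpleGraph (Fin n)) (source : Fin n) (ω : Fin n → A.Seed) :
    ℕ → Fin n → List Observation
  | 0 => fun _ => []
  | r + 1 => fun v =>
      observe G (fun u => A.nodeAction source u (ω u) (history G source ω r u)) v ::
        history G source ω r v

/-- After `r` rounds every node has the broadcast message. -/
def SolvedBy (G : SimpleGraph (Fin n)) (source : Fin n) (ω : Fin n → A.Seed) (r : ℕ) : Prop :=
  ∀ v, HasMessage source v (A.history G source ω r v)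

/-- The number of rounds until every node has the broadcast message (`⊤` if this never happens). -/
noncomputable def broadcastTime (G : SimpleGraph (Fin n)) (source : Fin n)
    (ω : Fin n → A.Seed) : ℕ∞ :=
  sInf {t : ℕ∞ | ∃ r : ℕ, t = (r : ℕ∞) ∧ A.SolvedBy G source ω r}

/-- The expected number of rounds until broadcast is solved, the nodes' seeds being independent. -/
noncomputable def expectedTime (G : SimpleGraph (Fin n)) (source : Fin n) : ℝ≥0∞ :=
  ∫⁻ ω, (A.broadcastTime G source ω : ℝ≥0∞) ∂(Measure.pi (fun _ : Fin n => A.seedLaw))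

end Algorithm

end Execution

/-- `G` is a network of diameter `D`: a connected graph whose diameter is `D`. -/
def IsNetwork {n : ℕ} (G : SimpleGraph (Fin n)) (D : ℕ) : Prop :=
  G.Connected ∧ G.diam = D

/-- `G` is a unit disk graph: its vertices can be placed in the Euclidean plane so that two
distinct vertices are adjacent iff their distance is at most `1`. -/
def IsUnitDiskGraph {V : Type*} (G : SimpleGraph V) : Prop :=
  ∃ pos : V → EuclideanSpace ℝ (Fin 2),
    ∀ u v : V, u ≠ v → (G.Adj u v ↔ dist (pos u) (pos v) ≤ 1)

/-- The algorithm (given `n`, `C` and `D` as parameters) solves global broadcast in `f n C D`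
rounds in expectation, on every multihop network (`2 ≤ D`) and from every source. -/
def SolvesBroadcastIn (A : (n C D : ℕ) → [NeZero C] → Algorithm.{u} n C) (f : ℕ → ℕ → ℕ → ℝ) : Prop :=
  ∀ (n C D : ℕ) [NeZero C] (G : SimpleGraph (Fin n)) (source : Fin n), 2 ≤ D → IsNetwork G D →
    (A n C D).expectedTime G source ≤ ENNReal.ofReal (f n C D)

end RadioNetwork

/-! The hard networks are chains of about `D / 2` cliques with `2 ^ M` members each, where `2 ^ M`
is of order `n / D`. Consecutive cliques are joined through a gateway that hears only a hidden
subset of the clique before it. Nodes beyond a clique stay silent until the message passes it, so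
the execution up to that round carries no information about the hidden subset. The gateway listens
on the default channel, so the message passes only when exactly one member of the hidden subset
transmits there; further channels do not help.

The hidden subset is a dyadic block whose scale `j ≤ M` and position are uniform. Whatever set
transmits, it meets the block in exactly one point for at most a fraction `2 / (M + 1)` of the
choices (`card_isolates_le`). Hence for at least half of the choices none of the first `(M + 1) / 4`
rounds after the clique is reached succeeds (`card_le_two_mul_card_delayed`). Delays add up along
the chain (`card_delayed_mul_le`).

These bounds hold for every fixed choice of seeds. Averaging over all block choices and integrating
over the seeds gives one network that is slow in expectation (`exists_expectedTime_ge`). -/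

namespace RadioNetwork

/-! ### Dyadic blocks and isolation -/

section Combinatorics

/-- Exactly one element of `T` lies in the dyadic block of length `2 ^ j` around `b`. -/
def Isolates (T : Finset ℕ) (j b : ℕ) : Prop :=
  ∃! x, x ∈ T ∧ x / 2 ^ j = b / 2 ^ j

theorem div_two_pow_eq_of_le {x b j J : ℕ} (hj : j ≤ J) (h : x / 2 ^ j = b / 2 ^ j) :
    x / 2 ^ J = b / 2 ^ J := by
  obtain ⟨d, rfl⟩ := Nat.exists_eq_add_of_le hj
  rw [pow_add, ← Nat.div_div_eq_div_mul, ← Nat.div_div_eq_div_mul, h]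

theorem mul_two_pow_add_div {o J b : ℕ} (hb : b < 2 ^ J) : (o * 2 ^ J + b) / 2 ^ J = o := by
  rw [Nat.add_comm, Nat.add_mul_div_right _ _ (by positivity), Nat.div_eq_of_lt hb, zero_add]

open Classical in
/-- The number of pairs of a scale `j ≤ J` and a point of the `o`-th dyadic block of length `2 ^ J`
whose block of length `2 ^ j` isolates an element of `T`. -/
noncomputable def isolationCount (T : Finset ℕ) (J o : ℕ) : ℕ :=
  ∑ j ∈ Finset.range (J + 1), ∑ b ∈ Finset.range (2 ^ J),
    if Isolates T j (o * 2 ^ J + b) then 1 else 0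

theorem isolationCount_eq_zero {T : Finset ℕ} {J o : ℕ} (h : ∀ x ∈ T, x / 2 ^ J ≠ o) :
    isolationCount T J o = 0 := by
  refine Finset.sum_eq_zero fun j hj => Finset.sum_eq_zero fun b hb => if_neg ?_
  rintro ⟨x, ⟨hx, hxb⟩, -⟩
  refine h x hx ?_
  rw [div_two_pow_eq_of_le (Nat.lt_succ_iff.1 (Finset.mem_range.1 hj)) hxb,
    mul_two_pow_add_div (Finset.mem_range.1 hb)]

open Classical in
theorem isolationCount_succ (T : Finset ℕ) (J o : ℕ) :
    isolationCount T (J + 1) o =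
      isolationCount T J (2 * o) + isolationCount T J (2 * o + 1) +
        if Isolates T (J + 1) (o * 2 ^ (J + 1)) then 2 ^ (J + 1) else 0 := by
  unfold isolationCount
  rw [Finset.sum_range_succ]
  congr 1
  · rw [← Finset.sum_add_distrib]
    refine Finset.sum_congr rfl fun j _ => ?_
    rw [show 2 ^ (J + 1) = 2 ^ J + 2 ^ J by ring, Finset.sum_range_add]
    congr 1 <;> refine Finset.sum_congr rfl fun b _ => ?_
    · rw [show o * (2 ^ J + 2 ^ J) + b = 2 * o * 2 ^ J + b by ring]
    · rw [show o * (2 ^ J + 2 ^ J) + (2 ^ J + b) = (2 * o + 1) * 2 ^ J + b by ring]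
  · have : ∀ b ∈ Finset.range (2 ^ (J + 1)),
        (if Isolates T (J + 1) (o * 2 ^ (J + 1) + b) then 1 else 0) =
          if Isolates T (J + 1) (o * 2 ^ (J + 1)) then 1 else 0 := by
      intro b hb
      unfold Isolates
      rw [mul_two_pow_add_div (Finset.mem_range.1 hb), Nat.mul_div_cancel _ (by positivity)]
    rw [Finset.sum_congr rfl this]
    split_ifs <;> simp

/-- Induction on the scale. If the whole block contains just one element of `T`, the half without it
is empty and counts zero, which pays for the top-scale term `2 ^ (J + 1)`. Otherwise that term
vanishes and the two halves add up. -/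
theorem isolationCount_le (T : Finset ℕ) (J o : ℕ) : isolationCount T J o ≤ 2 * 2 ^ J := by
  classical
  induction J generalizing o with
  | zero => simp only [isolationCount, pow_zero, zero_add, Finset.sum_range_one]; split_ifs <;> simp
  | succ J ih =>
    rw [isolationCount_succ]
    have h0 := ih (2 * o)
    have h1 := ih (2 * o + 1)
    have hp : 2 ^ (J + 1) = 2 * 2 ^ J := by ring
    split_ifs with h
    · obtain ⟨x, -, hu⟩ := h
      rw [Nat.mul_div_cancel _ (by positivity)] at hu
      have key : ∀ y ∈ T, y / 2 ^ J = 2 * o ∨ y / 2 ^ J = 2 * o + 1 → y = x := by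
        intro y hy hyo
        refine hu y ⟨hy, ?_⟩
        rw [pow_succ, ← Nat.div_div_eq_div_mul]
        omega
      by_cases hx : x / 2 ^ J = 2 * o
      · have : isolationCount T J (2 * o + 1) = 0 := isolationCount_eq_zero fun y hy hyo => by
          have := key y hy (Or.inr hyo)
          subst this
          omega
        omega
      · have : isolationCount T J (2 * o) = 0 := isolationCount_eq_zero fun y hy hyo => by
          have := key y hy (Or.inl hyo)
          subst this
          omega
        omega
    · omega

open Classical in
-- Out of `(M + 1) * 2 ^ M` pairs, this is a fraction of `2 / (M + 1)`: the origin of the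
-- logarithmic factor.
theorem card_isolates_le (T : Finset ℕ) (M : ℕ) :
    (Finset.univ.filter fun x : Fin (M + 1) × Fin (2 ^ M) => Isolates T x.1 x.2).card ≤
      2 * 2 ^ M := by
  have h := isolationCount_le T M 0
  unfold isolationCount at h
  simp only [zero_mul, zero_add] at h
  rw [Finset.card_filter, Fintype.sum_prod_type]
  refine le_trans (le_of_eq ?_) h
  rw [← Fin.sum_univ_eq_sum_range
    (fun j => ∑ b ∈ Finset.range (2 ^ M), if Isolates T j b then 1 else 0)]
  exact Finset.sum_congr rfl fun j _ =>
    Fin.sum_univ_eq_sum_range (fun b => if Isolates T j b then 1 else 0) _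

open Classical in
/-- An event that, whatever the other coordinates, holds for at least half of the values of
coordinate `i`, holds for at least half of all functions. -/
theorem card_pi_le_two_mul_card {ι P : Type*} [Fintype ι] [DecidableEq ι] [Fintype P]
    (i : ι) (good : (ι → P) → Prop)
    (h : ∀ p : ι → P, Fintype.card P ≤
      2 * (Finset.univ.filter fun x => good (Function.update p i x)).card) :
    Fintype.card (ι → P) ≤ 2 * (Finset.univ.filter good).card := by
  have hc : Fintype.card (ι → P) = Fintype.card ({j // j ≠ i} → P) * Fintype.card P := by
    rw [Fintype.card_congr (Equiv.funSplitAt i P), Fintype.card_prod, mul_comm]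
  rcases isEmpty_or_nonempty P with hP | ⟨⟨x₀⟩⟩
  · rw [hc, Fintype.card_eq_zero (α := P)]; simp
  rw [hc, Finset.card_filter, ← (Equiv.funSplitAt i P).symm.sum_comp, Fintype.sum_prod_type_right,
    Finset.mul_sum, ← smul_eq_mul, ← Finset.card_univ (α := {j // j ≠ i} → P),
    ← Finset.sum_const]
  refine Finset.sum_le_sum fun g _ => ?_
  -- The value `x₀` only completes `g` to a full function; `Function.update` overwrites it.
  refine (h ((Equiv.funSplitAt i P).symm (x₀, g))).trans (le_of_eq ?_)
  rw [Finset.card_filter]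
  congr 1
  refine Finset.sum_congr rfl fun x _ => ?_
  congr 2
  funext j
  by_cases hj : j = i
  · subst hj; simp [Equiv.funSplitAt, Equiv.piSplitAt]
  · simp [Equiv.funSplitAt, Equiv.piSplitAt, hj]

end Combinatorics

/-! ### Proximity graphs on a line and their diameter -/

section Proximity

/-- The graph on points of the line with natural coordinates in which two distinct points are
adjacent iff their distance is at most `2`. -/
def proximityGraph {V : Type*} (pos : V → ℕ) : SimpleGraph V where
  Adj u v := u ≠ v ∧ pos u ≤ pos v + 2 ∧ pos v ≤ pos u + 2
  symm := ⟨fun _ _ h => ⟨h.1.symm, h.2.2, h.2.1⟩⟩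
  loopless := ⟨fun _ h => h.1 rfl⟩

theorem isUnitDiskGraph_proximityGraph {V : Type*} (pos : V → ℕ) :
    IsUnitDiskGraph (proximityGraph pos) := by
  refine ⟨fun v => EuclideanSpace.single 0 ((pos v : ℝ) / 2), fun u v huv => ?_⟩
  rw [PiLp.dist_single_same, Real.dist_eq, abs_le]
  simp only [proximityGraph, ne_eq, huv, not_false_eq_true, true_and]
  rw [← Nat.cast_le (α := ℝ), ← Nat.cast_le (α := ℝ)]
  push_cast
  constructor <;> rintro ⟨h1, h2⟩ <;> constructor <;> linarith

variable {V : Type*} {pos : V → ℕ}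

/-- The number `(pos v + 1) / 2` serves as a hop count: an edge changes positions by at most 2,
hence this number by at most 1. It yields the lower bound on the diameter. -/
theorem hop_le_hop_add_dist {u v : V} (h : (proximityGraph pos).Reachable u v) :
    (pos v + 1) / 2 ≤ (pos u + 1) / 2 + (proximityGraph pos).dist u v := by
  obtain ⟨w, hw⟩ := h.exists_walk_length_eq_dist
  rw [← hw]
  clear hw h
  induction w with
  | nil => simp
  | cons h _ ih =>
    have := h.2
    rw [SimpleGraph.Walk.length_cons]
    omega

/-- `v` can be reached from `u` by a walk of length at most `d`. -/
theorem exists_walk_le_succ {G : SimpleGraph V} {u v w : V} {d : ℕ}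
    (h : ∃ p : G.Walk u v, p.length ≤ d) (hvw : v = w ∨ G.Adj v w) :
    ∃ p : G.Walk u w, p.length ≤ d + 1 := by
  obtain ⟨p, hp⟩ := h
  rcases hvw with rfl | hvw
  · exact ⟨p, by omega⟩
  · exact ⟨p.concat hvw, by rw [SimpleGraph.Walk.length_concat]; omega⟩

/-- A node at position `2 * h` is adjacent to all other nodes of hops `h` and `h + 1`. Such nodes
form a spine, and a walk enters the spine within the hop of its start and then climbs. -/
theorem isNetwork_proximityGraph {n : ℕ} {pos : Fin n → ℕ} {D : ℕ} (hD : 2 ≤ D)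
    (hle : ∀ v, pos v ≤ 2 * D) (hb : ∀ h < D, ∃ v, pos v = 2 * h)
    (hlast : ∃ v, 2 * D ≤ pos v + 1) (hfirst : ∀ u v, pos u = 0 → pos v = 0 → u = v) :
    IsNetwork (proximityGraph pos) D := by
  set G := proximityGraph pos with hG
  have hb' : ∀ h ≤ D, ∃ v, (h < D → pos v = 2 * h) ∧ (pos v + 1) / 2 = h := by
    intro h hh
    rcases hh.lt_or_eq with hlt | rfl
    · obtain ⟨v, hv⟩ := hb h hlt
      exact ⟨v, fun _ => hv, by omega⟩
    · obtain ⟨v, hv⟩ := hlast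
      have := hle v
      exact ⟨v, fun h => absurd h (lt_irrefl _), by omega⟩
  choose b hb1 hb2 using hb'
  have same : ∀ v (h : ℕ) (hh : h ≤ D), (pos v + 1) / 2 = h → b h hh = v ∨ G.Adj (b h hh) v := by
    intro v h hh hv
    by_cases e : b h hh = v
    · exact Or.inl e
    · have := hb2 h hh
      exact Or.inr ⟨e, by omega, by omega⟩
  have step : ∀ v (h : ℕ) (hh : h < D), (pos v + 1) / 2 = h + 1 → G.Adj (b h hh.le) v := by
    intro v h hh hv
    have := hb1 h hh.le hh
    refine ⟨?_, by omega, by omega⟩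
    rintro rfl
    omega
  have spine : ∀ (d g : ℕ) (hg : g + d ≤ D),
      ∃ p : G.Walk (b g (by omega)) (b (g + d) hg), p.length ≤ d := by
    intro d
    induction d with
    | zero => exact fun g hg => ⟨SimpleGraph.Walk.nil, le_rfl⟩
    | succ d ih =>
      intro g hg
      exact exists_walk_le_succ (ih g (by omega)) (Or.inr (step _ _ (by omega) (hb2 _ _)))
  have fromSpine : ∀ (g : ℕ) (hg : g ≤ D) (v : Fin n), g ≤ (pos v + 1) / 2 →
      ∃ p : G.Walk (b g hg) v, p.length ≤ max ((pos v + 1) / 2 - g) 1 := by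
    intro g hg v hv
    rcases hv.eq_or_lt with e | hlt
    · obtain ⟨p, hp⟩ := exists_walk_le_succ
        (⟨SimpleGraph.Walk.nil, le_rfl⟩ : ∃ p : G.Walk (b g hg) (b g hg), p.length ≤ 0)
        (same v g hg e.symm)
      exact ⟨p, hp.trans (le_max_right _ _)⟩
    · obtain ⟨d, hd⟩ := Nat.exists_eq_add_of_lt hlt
      have := hle v
      obtain ⟨p, hp⟩ := exists_walk_le_succ (spine d g (by omega))
        (Or.inr (step v (g + d) (by omega) hd))
      exact ⟨p, hp.trans ((by omega : d + 1 ≤ (pos v + 1) / 2 - g).trans (le_max_left _ _))⟩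
  have walk' : ∀ u v : Fin n, (pos u + 1) / 2 ≤ (pos v + 1) / 2 →
      ∃ p : G.Walk u v, p.length ≤ D := by
    intro u v huv
    have hv := hle v
    have hu := hle u
    obtain ⟨p, hp⟩ := fromSpine ((pos u + 1) / 2) (by omega) v huv
    -- Outside position 0 one edge is reserved for stepping from `u` to the spine; hop 0 has a
    -- single node, which is on the spine. When the hops agree, `2 ≤ D` leaves room for both edges.
    have hmax : max ((pos v + 1) / 2 - (pos u + 1) / 2) 1 ≤ D - (if pos u = 0 then 0 else 1) := by
      split_ifs <;> omega
    split_ifs at hmax with h0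
    · have h1 := hb1 ((pos u + 1) / 2) (by omega) (by omega)
      have h2 : b ((pos u + 1) / 2) (by omega) = u := hfirst _ _ (by omega) h0
      exact ⟨p.copy h2 rfl, by rw [SimpleGraph.Walk.length_copy]; omega⟩
    · rcases same u _ (by omega) rfl with h | h
      · exact ⟨p.copy h rfl, by rw [SimpleGraph.Walk.length_copy]; omega⟩
      · exact ⟨SimpleGraph.Walk.cons h.symm p, by rw [SimpleGraph.Walk.length_cons]; omega⟩
  have walk : ∀ u v : Fin n, ∃ p : G.Walk u v, p.length ≤ D := by
    intro u v
    rcases le_total ((pos u + 1) / 2) ((pos v + 1) / 2) with h | h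
    · exact walk' u v h
    · obtain ⟨p, hp⟩ := walk' v u h
      exact ⟨p.reverse, by rwa [SimpleGraph.Walk.length_reverse]⟩
  obtain ⟨s, hs⟩ := hb 0 (by omega)
  obtain ⟨t, ht⟩ := hlast
  have : Nonempty (Fin n) := ⟨s⟩
  have hconn : G.Connected := ⟨fun u v => (walk u v).choose.reachable⟩
  refine ⟨hconn, le_antisymm ?_ ?_⟩
  · obtain ⟨u, v, huv⟩ := G.exists_dist_eq_diam
    obtain ⟨p, hp⟩ := walk u v
    rw [← huv]
    exact (SimpleGraph.dist_le p).trans hp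
  · have h1 := hop_le_hop_add_dist (hconn s t)
    rw [← hG] at h1
    have h2 : G.dist s t ≤ G.diam := SimpleGraph.dist_le_diam
      (SimpleGraph.connected_iff_ediam_ne_top.1 hconn)
    omega

end Proximity

/-! ### Single rounds of the execution -/

section Rounds

variable {n C : ℕ}

theorem Action.exists_eq_transmit_of_sentOn_ne_none {c : Fin C} {a : Action C}
    (h : a.sentOn c ≠ none) : ∃ p, a = .transmit c p := by
  cases a with
  | listen _ => exact absurd rfl h
  | transmit c' p =>
    by_cases hc : c' = c
    · exact ⟨p, by rw [hc]⟩
    · exact absurd (if_neg hc) h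

theorem HasMessage.cons {source v : Fin n} {h : List Observation} (hm : HasMessage source v h)
    (o : Observation) : HasMessage source v (o :: h) :=
  hm.imp_right fun ⟨p, hp, hb⟩ => ⟨p, List.mem_cons_of_mem _ hp, hb⟩

theorem arriving_congr {G G' : SimpleGraph (Fin n)} {a : Fin n → Action C} {v : Fin n} {c : Fin C}
    (h : ∀ u, (a u).sentOn c ≠ none → (G.Adj v u ↔ G'.Adj v u)) :
    arriving G a v c = arriving G' a v c := by
  classical
  unfold arriving
  rw [List.filterMap_filter, List.filterMap_filter]
  refine List.filterMap_congr fun u _ => ?_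
  by_cases hu : (a u).sentOn c = none
  · simp [hu]
  · simp [h u hu]

theorem observe_congr {G G' : SimpleGraph (Fin n)} {a : Fin n → Action C} {v : Fin n}
    (h : ∀ u c p, a u = .transmit c p → (G.Adj v u ↔ G'.Adj v u)) :
    observe G a v = observe G' a v := by
  unfold observe
  cases a v with
  | transmit _ _ => rfl
  | listen c =>
    have : arriving G a v c = arriving G' a v c := arriving_congr fun u hu => by
      obtain ⟨p, hp⟩ := Action.exists_eq_transmit_of_sentOn_ne_none hu
      exact h u c p hp
    simp only [this]

theorem exists_unique_sender_of_observe {G : SimpleGraph (Fin n)} {a : Fin n → Action C}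
    {v : Fin n} {c : Fin C} {p : Packet} (hv : a v = .listen c) (h : observe G a v = .received p) :
    ∃ u, G.Adj v u ∧ (a u).sentOn c ≠ none ∧
      ∀ u', G.Adj v u' → (a u').sentOn c ≠ none → u' = u := by
  classical
  have hl : (arriving G a v c).length = 1 := by
    unfold observe at h
    rw [hv] at h
    revert h
    dsimp only
    rcases arriving G a v c with - | ⟨q, - | ⟨q', l⟩⟩ <;> simp
  unfold arriving at hl
  rw [List.length_filterMap_eq_countP, List.countP_eq_length_filter, List.filter_filter,
    List.length_eq_one_iff] at hl
  obtain ⟨u, hu⟩ := hl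
  have hmem : ∀ w, G.Adj v w ∧ (a w).sentOn c ≠ none ↔ w = u := by
    intro w
    rw [← List.mem_singleton, ← hu]
    simp [List.mem_filter, Option.isSome_iff_ne_none, and_comm]
  exact ⟨u, ((hmem u).2 rfl).1, ((hmem u).2 rfl).2, fun u' h1 h2 => (hmem u').1 ⟨h1, h2⟩⟩

variable [NeZero C] (A : Algorithm n C)

theorem hasMessage_history_mono {G : SimpleGraph (Fin n)} {source v : Fin n} {ω : Fin n → A.Seed}
    {r r' : ℕ} (hr : r ≤ r') (h : HasMessage source v (A.history G source ω r v)) :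
    HasMessage source v (A.history G source ω r' v) := by
  induction r', hr using Nat.le_induction with
  | base => exact h
  | succ r' _ ih => exact ih.cons _

/-- The actions of all nodes in round `r + 1`. -/
noncomputable def Algorithm.actions (G : SimpleGraph (Fin n)) (source : Fin n)
    (ω : Fin n → A.Seed) (r : ℕ) (u : Fin n) : Action C :=
  A.nodeAction source u (ω u) (A.history G source ω r u)

theorem history_succ (G : SimpleGraph (Fin n)) (source : Fin n) (ω : Fin n → A.Seed) (r : ℕ)
    (v : Fin n) : A.history G source ω (r + 1) v =
      observe G (A.actions G source ω r) v :: A.history G source ω r v := rfl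

variable {A}

theorem actions_of_not_hasMessage {G : SimpleGraph (Fin n)} {source : Fin n}
    {ω : Fin n → A.Seed} {r : ℕ} {u : Fin n}
    (h : ¬ HasMessage source u (A.history G source ω r u)) :
    A.actions G source ω r u = .listen 0 := if_neg h

theorem exists_received_of_hasMessage_succ {G : SimpleGraph (Fin n)} {source : Fin n}
    {ω : Fin n → A.Seed} {r : ℕ} {v : Fin n}
    (h : ¬ HasMessage source v (A.history G source ω r v))
    (h' : HasMessage source v (A.history G source ω (r + 1) v)) :
    ∃ p, observe G (A.actions G source ω r) v = .received p := by
  rcases h' with h' | ⟨p, hp, hb⟩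
  · exact absurd (Or.inl h') h
  · rw [history_succ, List.mem_cons] at hp
    rcases hp with hp | hp
    · exact ⟨p, hp.symm⟩
    · exact absurd (Or.inr ⟨p, hp, hb⟩) h

end Rounds

/-! ### Chains of cliques and the passage of the message -/

section Chain

open Classical in
/-- Coordinates of a chain of cliques: level `i` consists of gateways `(i, none)` and clique members
`(i, some x)`; those with `σ i x` are placed within reach of the gateways of level `i + 1`. -/
noncomputable def chainPos (σ : ℕ → ℕ → Prop) : ℕ × Option ℕ → ℕ
  | (i, none) => 4 * i
  | (i, some x) => 4 * i + if σ i x then 2 else 1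

/-- The chain of cliques in which node `v` has the location `loc v`. -/
noncomputable abbrev chainGraph {V : Type*} (loc : V → ℕ × Option ℕ) (σ : ℕ → ℕ → Prop) :
    SimpleGraph V :=
  proximityGraph fun v => chainPos σ (loc v)

/-- The links of the levels below `i`. -/
def linksBelow (i : ℕ) (σ : ℕ → ℕ → Prop) (j x : ℕ) : Prop := j < i ∧ σ j x

theorem chainPos_linksBelow_of_lt (σ : ℕ → ℕ → Prop) {i : ℕ} {l : ℕ × Option ℕ} (h : l.1 < i) :
    chainPos (linksBelow i σ) l = chainPos σ l := by
  obtain ⟨j, - | x⟩ := l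
  · rfl
  · have : j < i := h
    by_cases hx : σ j x <;> simp [chainPos, linksBelow, this, hx]

theorem chainPos_linksBelow_of_le (σ : ℕ → ℕ → Prop) {i x : ℕ} {j : ℕ} (h : i ≤ j) :
    chainPos (linksBelow i σ) (j, some x) = 4 * j + 1 := by
  simp [chainPos, linksBelow, h.not_gt]

theorem chainPos_bounds (σ : ℕ → ℕ → Prop) (l : ℕ × Option ℕ) :
    4 * l.1 ≤ chainPos σ l ∧ chainPos σ l ≤ 4 * l.1 + 2 := by
  obtain ⟨j, - | x⟩ := l
  · simp [chainPos]
  · simp only [chainPos]; split_ifs <;> omega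

theorem four_mul_lt_chainPos (σ : ℕ → ℕ → Prop) (i x : ℕ) : 4 * i < chainPos σ (i, some x) := by
  simp only [chainPos]; split_ifs <;> omega

variable {n C : ℕ} {loc : Fin n → ℕ × Option ℕ} {σ : ℕ → ℕ → Prop} {i : ℕ}

/-- A link moves a member of level `i` from `4 * i + 1` to `4 * i + 2`. Both places are within reach
of all of level `i` and out of reach of the lower levels. -/
theorem chainGraph_adj_iff_of_le {u v : Fin n} (hu : (loc u).1 ≤ i) (hv : (loc v).1 ≤ i) :
    (chainGraph loc σ).Adj u v ↔ (chainGraph loc (linksBelow i σ)).Adj u v := by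
  have key : ∀ w, (loc w).1 ≤ i →
      chainPos (linksBelow i σ) (loc w) = chainPos σ (loc w) ∨
      4 * i < chainPos (linksBelow i σ) (loc w) ∧ 4 * i < chainPos σ (loc w) ∧ (loc w).1 = i := by
    intro w hw
    rcases hw.lt_or_eq with h | h
    · exact Or.inl (chainPos_linksBelow_of_lt σ h)
    · rcases hl : loc w with ⟨j, - | x⟩
      · exact Or.inl rfl
      · rw [hl] at h
        obtain rfl : j = i := h
        exact Or.inr ⟨four_mul_lt_chainPos _ _ _, four_mul_lt_chainPos _ _ _, rfl⟩
  simp only [chainGraph, proximityGraph]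
  have b1 := chainPos_bounds σ (loc u)
  have b2 := chainPos_bounds σ (loc v)
  have b3 := chainPos_bounds (linksBelow i σ) (loc u)
  have b4 := chainPos_bounds (linksBelow i σ) (loc v)
  refine and_congr_right fun _ => ?_
  rcases key u hu with h | h <;> rcases key v hv with h' | h' <;> omega

theorem not_adj_linksBelow {u v : Fin n} (hu : (loc u).1 ≤ i) (hv : i < (loc v).1) :
    ¬ (chainGraph loc (linksBelow i σ)).Adj v u := by
  rintro ⟨-, h1, h2⟩
  dsimp only at h1 h2
  have b2 := chainPos_bounds (linksBelow i σ) (loc v)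
  have : chainPos (linksBelow i σ) (loc u) ≤ 4 * i + 1 := by
    rcases hu.lt_or_eq with h | h
    · have := chainPos_bounds (linksBelow i σ) (loc u); omega
    · rcases hl : loc u with ⟨j, - | x⟩
      · rw [hl] at h
        obtain rfl : j = i := h
        simp [chainPos]
      · rw [hl] at h
        obtain rfl : j = i := h
        rw [chainPos_linksBelow_of_le _ le_rfl]
  omega

/-- The only pair of positions at distance at most 2 across the boundary is `4 * i + 2` and `4 * i +
4`. -/
theorem chainGraph_adj_cross {u v : Fin n} (hu : (loc u).1 ≤ i) (hv : i < (loc v).1)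
    (h : (chainGraph loc σ).Adj v u) :
    (∃ x, loc u = (i, some x) ∧ σ i x) ∧ loc v = (i + 1, none) := by
  obtain ⟨-, h1, h2⟩ := h
  dsimp only at h1 h2
  have b1 := chainPos_bounds σ (loc u)
  have b2 := chainPos_bounds σ (loc v)
  constructor
  · rcases hlu : loc u with ⟨j, - | x⟩ <;> rw [hlu] at h1 hu b1
    · rw [show chainPos σ (j, none) = 4 * j from rfl] at h1
      omega
    · obtain rfl : j = i := by omega
      by_cases hx : σ j x
      · exact ⟨x, rfl, hx⟩
      · rw [show chainPos σ (j, some x) = 4 * j + 1 by simp [chainPos, hx]] at h1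
        omega
  · rcases hlv : loc v with ⟨k, - | y⟩ <;> rw [hlv] at h1 hv b2
    · obtain rfl : k = i + 1 := by omega
      rfl
    · have := four_mul_lt_chainPos σ k y
      omega

theorem chainGraph_adj_of_link {u v : Fin n} {x : ℕ} (hu : loc u = (i, some x)) (hx : σ i x)
    (hv : loc v = (i + 1, none)) : (chainGraph loc σ).Adj v u := by
  refine ⟨?_, ?_⟩
  · rintro rfl
    rw [hu] at hv
    simp at hv
  · simp only [hu, hv, chainPos, if_pos hx]
    omega

variable [NeZero C] {A : Algorithm n C} {source : Fin n} {ω : Fin n → A.Seed}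

variable (loc A source ω) in
/-- After `r` rounds some node of level at least `i` has the message. -/
def Reached (σ : ℕ → ℕ → Prop) (i r : ℕ) : Prop :=
  ∃ v, i ≤ (loc v).1 ∧ HasMessage source v (A.history (chainGraph loc σ) source ω r v)

/-- As long as the message has not passed level `i`, the execution does not depend on the links out
of level `i` and beyond. -/
theorem history_linksBelow {r : ℕ} (h : ¬ Reached loc A source ω σ (i + 1) r) :
    (∀ v, (loc v).1 ≤ i → A.history (chainGraph loc (linksBelow i σ)) source ω r v =
      A.history (chainGraph loc σ) source ω r v) ∧
    ¬ Reached loc A source ω (linksBelow i σ) (i + 1) r := by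
  induction r with
  | zero => exact ⟨fun _ _ => rfl, h⟩
  | succ r ih =>
    have h0 : ¬ Reached loc A source ω σ (i + 1) r := fun ⟨v, hv, hm⟩ => h ⟨v, hv, hm.cons _⟩
    obtain ⟨ih1, ih2⟩ := ih h0
    -- Nodes beyond level `i` may perceive different things in the two networks, even collisions,
    -- but being inactive they listen regardless.
    have quiet : ∀ v, i < (loc v).1 →
        A.actions (chainGraph loc σ) source ω r v = .listen 0 := fun v hv =>
      actions_of_not_hasMessage fun hm => h0 ⟨v, hv, hm⟩
    have hact : A.actions (chainGraph loc (linksBelow i σ)) source ω r =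
        A.actions (chainGraph loc σ) source ω r := by
      funext v
      rcases le_or_gt (loc v).1 i with hv | hv
      · simp only [Algorithm.actions, ih1 v hv]
      · rw [quiet v hv]
        exact actions_of_not_hasMessage fun hm => ih2 ⟨v, hv, hm⟩
    have left : ∀ {u c p}, A.actions (chainGraph loc σ) source ω r u = .transmit c p →
        (loc u).1 ≤ i := fun {u _ _} ha => by
      by_contra hu
      rw [quiet u (not_le.1 hu)] at ha
      cases ha
    refine ⟨fun v hv => ?_, ?_⟩
    · rw [history_succ, history_succ, ih1 v hv, hact]
      congr 1
      exact observe_congr fun u c p ha => (chainGraph_adj_iff_of_le hv (left ha)).symm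
    · rintro ⟨v, hv, hm⟩
      have hv0 : ¬ HasMessage source v
          (A.history (chainGraph loc (linksBelow i σ)) source ω r v) := fun hm => ih2 ⟨v, hv, hm⟩
      obtain ⟨p, hp⟩ := exists_received_of_hasMessage_succ hv0 hm
      obtain ⟨u, hadj, hs, -⟩ := exists_unique_sender_of_observe
        (actions_of_not_hasMessage hv0) hp
      obtain ⟨q, hq⟩ := Action.exists_eq_transmit_of_sentOn_ne_none hs
      rw [hact] at hq
      exact not_adj_linksBelow (left hq) hv hadj

theorem reached_linksBelow_iff {r : ℕ} (h : ¬ Reached loc A source ω σ (i + 1) r) :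
    Reached loc A source ω (linksBelow i σ) i r ↔ Reached loc A source ω σ i r := by
  obtain ⟨h1, h2⟩ := history_linksBelow h
  constructor
  · rintro ⟨v, hv, hm⟩
    rcases hv.lt_or_eq with hlt | e
    · exact absurd ⟨v, hlt, hm⟩ h2
    · exact ⟨v, hv, by rwa [← h1 v e.ge]⟩
  · rintro ⟨v, hv, hm⟩
    rcases hv.lt_or_eq with hlt | e
    · exact absurd ⟨v, hlt, hm⟩ h
    · exact ⟨v, hv, by rwa [h1 v e.ge]⟩

open Classical in
variable (loc A source ω) in
/-- The members of the clique of level `i` that transmit on the default channel in round `r + 1`. -/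
noncomputable def transmitters (σ : ℕ → ℕ → Prop) (i r : ℕ) : Finset ℕ :=
  (Finset.univ.filter fun u => (loc u).1 = i ∧
    (A.actions (chainGraph loc σ) source ω r u).sentOn 0 ≠ none).biUnion
      fun u => (loc u).2.toFinset

theorem mem_transmitters {r x : ℕ} : x ∈ transmitters loc A source ω σ i r ↔
    ∃ u, loc u = (i, some x) ∧
      (A.actions (chainGraph loc σ) source ω r u).sentOn 0 ≠ none := by
  simp only [transmitters, Finset.mem_biUnion, Finset.mem_filter, Finset.mem_univ, true_and,
    Option.mem_toFinset, Option.mem_def]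
  refine exists_congr fun u => ?_
  rw [Prod.ext_iff]
  tauto

/-- The message passes level `i` only in a round in which exactly one of the transmitters, in the
execution without links out of level `i`, is linked to the next level. -/
theorem existsUnique_transmitter {r : ℕ} (h : ¬ Reached loc A source ω σ (i + 1) r)
    (h' : Reached loc A source ω σ (i + 1) (r + 1)) :
    Reached loc A source ω σ i r ∧
      ∃! x, x ∈ transmitters loc A source ω (linksBelow i σ) i r ∧ σ i x := by
  obtain ⟨v, hv, hm⟩ := h'
  have hv0 : ¬ HasMessage source v (A.history (chainGraph loc σ) source ω r v) :=
    fun hm => h ⟨v, hv, hm⟩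
  obtain ⟨p, hp⟩ := exists_received_of_hasMessage_succ hv0 hm
  -- The receiver `v` is still inactive, so it listens on channel `0`, and only transmissions there
  -- count.
  obtain ⟨u, hadj, hs, huniq⟩ := exists_unique_sender_of_observe
    (actions_of_not_hasMessage hv0) hp
  have active : HasMessage source u (A.history (chainGraph loc σ) source ω r u) := by
    by_contra hu
    rw [actions_of_not_hasMessage hu] at hs
    exact hs rfl
  have hu : (loc u).1 ≤ i := by
    by_contra hu
    exact h ⟨u, not_le.1 hu, active⟩
  obtain ⟨⟨x, hlu, hx⟩, hlv⟩ := chainGraph_adj_cross hu hv hadj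
  have hact : ∀ w, (loc w).1 ≤ i → A.actions (chainGraph loc (linksBelow i σ)) source ω r w =
      A.actions (chainGraph loc σ) source ω r w := fun w hw => by
    simp only [Algorithm.actions, (history_linksBelow h).1 w hw]
  refine ⟨⟨u, by rw [hlu], active⟩, x, ⟨mem_transmitters.2 ⟨u, hlu, ?_⟩, hx⟩, ?_⟩
  · rwa [hact u hu]
  · rintro y ⟨hy, hyσ⟩
    obtain ⟨w, hw, hws⟩ := mem_transmitters.1 hy
    rw [hact w (by rw [hw])] at hws
    obtain rfl := huniq w (chainGraph_adj_of_link hw hyσ hlv) hws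
    rw [hw] at hlu
    simpa using hlu

variable (loc A source ω) in
/-- No round among the first `m` ones after level `i` was reached lets the message pass level `i`.
Only the execution without links out of level `i` matters here. -/
def Delayed (m : ℕ) (σ : ℕ → ℕ → Prop) (i : ℕ) : Prop :=
  ∀ r, sInf {r | Reached loc A source ω (linksBelow i σ) i r} ≤ r →
    r < sInf {r | Reached loc A source ω (linksBelow i σ) i r} + m →
      ¬ ∃! x, x ∈ transmitters loc A source ω (linksBelow i σ) i r ∧ σ i x

theorem Reached.mono {r r' : ℕ} (hr : r ≤ r') (h : Reached loc A source ω σ i r) :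
    Reached loc A source ω σ i r' := by
  obtain ⟨v, hv, hm⟩ := h
  exact ⟨v, hv, hasMessage_history_mono A hr hm⟩

open Classical in
-- Induction on the level. If level `i` is first reached after `s` rounds and the next one after `t
-- + 1`, then `t` is a round with a unique linked transmitter, so a delay forces `s + m ≤ t`.
-- Passing a delayed level thus costs `m + 1` rounds, which is still positive when `m = 0`.
theorem card_delayed_mul_le (m : ℕ) (hs : (loc source).1 = 0) (i : ℕ) {r : ℕ}
    (h : Reached loc A source ω σ i r) :
    (m + 1) * ((Finset.range i).filter fun j => Delayed loc A source ω m σ j).card ≤ r := by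
  induction i generalizing r with
  | zero => simp
  | succ i ih =>
    have hex : ∃ r, Reached loc A source ω σ (i + 1) r := ⟨r, h⟩
    have hle := Nat.find_min' hex h
    -- Before the first round only the source has the message, and it lies in level 0.
    obtain ⟨t, ht⟩ : ∃ t, Nat.find hex = t + 1 := by
      refine Nat.exists_eq_succ_of_ne_zero fun h0 => ?_
      have := Nat.find_spec hex
      rw [h0] at this
      obtain ⟨v, hv, rfl | ⟨p, hp, -⟩⟩ := this
      · omega
      · exact absurd hp List.not_mem_nil
    have hnot : ∀ s ≤ t, ¬ Reached loc A source ω σ (i + 1) s := fun s hs =>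
      Nat.find_min hex (by omega)
    obtain ⟨hi, huniq⟩ := existsUnique_transmitter (hnot t le_rfl) (ht ▸ Nat.find_spec hex)
    set S := {r | Reached loc A source ω (linksBelow i σ) i r} with hS
    have htS : t ∈ S := (reached_linksBelow_iff (hnot t le_rfl)).2 hi
    have hst : sInf S ≤ t := Nat.sInf_le htS
    have hmem : sInf S ∈ S := Nat.sInf_mem ⟨t, htS⟩
    have := ih ((reached_linksBelow_iff (hnot _ hst)).1 hmem)
    rw [Finset.range_add_one, Finset.filter_insert]
    split_ifs with hd
    · have hm : sInf S + m ≤ t := by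
        by_contra hlt
        exact hd t hst (not_le.1 hlt) huniq
      rw [Finset.card_insert_of_notMem (by simp), Nat.mul_add]
      omega
    · omega

end Chain

/-! ### Measurability of the broadcast time -/

section Measurability

theorem countable_packet : Countable Packet :=
  Function.Injective.countable (f := fun p : Packet => (p.hasMsg, p.payload)) fun p q h => by
    cases p; cases q; simp_all

theorem countable_observation : Countable Observation := by
  have := countable_packet
  let f : Option (Option (Option Packet)) → Observation := fun
    | none => .sent
    | some none => .silence
    | some (some none) => .collision
    | some (some (some p)) => .received p
  refine Function.Surjective.countable (f := f) fun o => ?_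
  cases o with
  | sent => exact ⟨none, rfl⟩
  | silence => exact ⟨some none, rfl⟩
  | collision => exact ⟨some (some none), rfl⟩
  | received p => exact ⟨some (some (some p)), rfl⟩

theorem countable_action (C : ℕ) : Countable (Action C) := by
  have := countable_packet
  let f : Fin C ⊕ (Fin C × Packet) → Action C := Sum.elim .listen fun x => .transmit x.1 x.2
  refine Function.Surjective.countable (f := f) fun a => ?_
  cases a with
  | listen c => exact ⟨.inl c, rfl⟩
  | transmit c p => exact ⟨.inr (c, p), rfl⟩

variable {n C : ℕ} [NeZero C] (A : Algorithm n C) (G : SimpleGraph (Fin n)) (source : Fin n)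

theorem measurableSet_nodeAction_eq (u : Fin n) (h : List Observation) (a : Action C) :
    MeasurableSet {ω : Fin n → A.Seed | A.nodeAction source u (ω u) h = a} := by
  unfold Algorithm.nodeAction
  by_cases hm : HasMessage source u h
  · simp only [if_pos hm]
    exact MeasurableSet.preimage (A.measurable_act u (decide (u = source)) h a)
      (measurable_pi_apply (X := fun _ : Fin n => A.Seed) u)
  · simp only [if_neg hm]
    exact MeasurableSet.const _

/-- Observations and actions are countable, so each event splits into countably many cases with the
previous history and all actions fixed. -/
theorem measurableSet_history_eq (r : ℕ) (H : Fin n → List Observation) :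
    MeasurableSet {ω : Fin n → A.Seed | A.history G source ω r = H} := by
  have := countable_observation
  have := countable_action C
  induction r generalizing H with
  | zero => exact MeasurableSet.const ((fun _ => []) = H)
  | succ r ih =>
    have : {ω : Fin n → A.Seed | A.history G source ω (r + 1) = H} =
        ⋃ (H' : Fin n → List Observation) (a : Fin n → Action C),
          {ω | A.history G source ω r = H'} ∩
            (⋂ u, {ω | A.nodeAction source u (ω u) (H' u) = a u}) ∩
            {_ω | (fun v => observe G a v :: H' v) = H} := by
      ext ω
      simp only [Set.mem_iUnion, Set.mem_inter_iff, Set.mem_iInter, Set.mem_ofPred_eq]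
      constructor
      · intro h
        exact ⟨_, A.actions G source ω r, ⟨rfl, fun _ => rfl⟩, h⟩
      · rintro ⟨H', a, ⟨rfl, ha⟩, h⟩
        rw [← h]
        funext v
        rw [history_succ, show A.actions G source ω r = a from funext ha]
    rw [this]
    exact MeasurableSet.iUnion fun H' => MeasurableSet.iUnion fun a =>
      ((ih H').inter (MeasurableSet.iInter fun u =>
        measurableSet_nodeAction_eq A source u _ _)).inter (MeasurableSet.const _)

theorem measurableSet_solvedBy (r : ℕ) :
    MeasurableSet {ω : Fin n → A.Seed | A.SolvedBy G source ω r} := by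
  have := countable_observation
  have : {ω : Fin n → A.Seed | A.SolvedBy G source ω r} =
      ⋃ H : Fin n → List Observation, {ω | A.history G source ω r = H} ∩
        {_ω | ∀ v, HasMessage source v (H v)} := by
    ext ω
    simp [Algorithm.SolvedBy]
  rw [this]
  exact MeasurableSet.iUnion fun H =>
    (measurableSet_history_eq A G source r H).inter (MeasurableSet.const _)

theorem le_broadcastTime_iff (ω : Fin n → A.Seed) (t : ℕ∞) :
    t ≤ A.broadcastTime G source ω ↔ ∀ r : ℕ, A.SolvedBy G source ω r → t ≤ r := by
  unfold Algorithm.broadcastTime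
  rw [le_sInf_iff]
  constructor
  · exact fun h r hr => h _ ⟨r, rfl, hr⟩
  · rintro h _ ⟨r, rfl, hr⟩
    exact h r hr

theorem measurable_broadcastTime : Measurable fun ω => A.broadcastTime G source ω := by
  have hle : ∀ t : ℕ∞, MeasurableSet {ω | t ≤ A.broadcastTime G source ω} := by
    intro t
    simp only [le_broadcastTime_iff, Set.ofPred_forall]
    refine MeasurableSet.iInter fun r => ?_
    by_cases h : t ≤ r
    · simp [h]
    · simp only [h, imp_false]
      exact (measurableSet_solvedBy A G source r).compl
  refine ENat.measurable_iff.2 fun m => ?_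
  have : (fun ω => A.broadcastTime G source ω) ⁻¹' {(m : ℕ∞)} =
      {ω | (m : ℕ∞) ≤ A.broadcastTime G source ω} \
        {ω | ((m + 1 : ℕ) : ℕ∞) ≤ A.broadcastTime G source ω} := by
    ext ω
    simp only [Set.mem_preimage, Set.mem_singleton_iff, Set.mem_sdiff, Set.mem_ofPred_eq]
    rw [Nat.cast_add, Nat.cast_one, ENat.add_one_le_iff (ENat.natCast_ne_top m), not_lt,
      ← le_antisymm_iff, eq_comm]
  rw [this]
  exact (hle _).diff (hle _)

/-- Needed to exchange the finite sum over networks with the integral over seeds. -/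
theorem measurable_coe_broadcastTime :
    Measurable fun ω => (A.broadcastTime G source ω : ℝ≥0∞) :=
  (measurable_from_top (f := fun t : ℕ∞ => (t : ℝ≥0∞))).comp
    (measurable_broadcastTime A G source)

end Measurability

/-! ### The family of hard networks and averaging -/

section HardInstances

/-- Node locations: `L` cliques of `k` members, each preceded by a gateway, and a last gateway at
level `L`, which the remaining nodes join (`e = 0`) or follow as clique members (`e = 1`). -/
def chainLoc (L k e a : ℕ) : ℕ × Option ℕ :=
  if a < L * (k + 1) then
    (a / (k + 1), if a % (k + 1) = 0 then none else some (a % (k + 1) - 1))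
  else (L, if e = 1 ∧ a ≠ L * (k + 1) then some 0 else none)

variable {L k e : ℕ}

theorem chainLoc_gateway {i : ℕ} (hi : i < L) : chainLoc L k e (i * (k + 1)) = (i, none) := by
  rw [chainLoc, if_pos (Nat.mul_lt_mul_of_pos_right hi k.succ_pos)]
  simp

theorem add_lt_mul_succ {i x : ℕ} (hi : i < L) (hx : x < k) :
    i * (k + 1) + (x + 1) < L * (k + 1) := by
  have := Nat.mul_le_mul_right (k + 1) (Nat.succ_le_of_lt hi)
  rw [Nat.succ_mul] at this
  omega

theorem chainLoc_member {i x : ℕ} (hi : i < L) (hx : x < k) :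
    chainLoc L k e (i * (k + 1) + (x + 1)) = (i, some x) := by
  have hx' : x + 1 < k + 1 := by omega
  have h1 : (i * (k + 1) + (x + 1)) % (k + 1) = x + 1 := by
    rw [Nat.mul_add_mod', Nat.mod_eq_of_lt hx']
  have h2 : (i * (k + 1) + (x + 1)) / (k + 1) = i := by
    rw [Nat.add_comm, Nat.add_mul_div_right _ _ k.succ_pos, Nat.div_eq_of_lt hx', zero_add]
  rw [chainLoc, if_pos (add_lt_mul_succ hi hx), h1, h2]
  simp

theorem chainLoc_end : chainLoc L k e (L * (k + 1)) = (L, none) := by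
  simp [chainLoc]

theorem chainLoc_fst_zero (hL : 0 < L) : (chainLoc L k e 0).1 = 0 := by
  simp [chainLoc, hL]

/-- The choice of a dyadic block of clique members for every level, as a relation. -/
def blockLinks {L M : ℕ} (p : Fin L → Fin (M + 1) × Fin (2 ^ M)) (i x : ℕ) : Prop :=
  ∃ h : i < L, x / 2 ^ (p ⟨i, h⟩).1.val = (p ⟨i, h⟩).2.val / 2 ^ (p ⟨i, h⟩).1.val

theorem isNetwork_blockLinks {n D M : ℕ} (hD : 2 ≤ D) (hn : D / 2 * (2 ^ M + 1) + 1 + D % 2 ≤ n)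
    (p : Fin (D / 2) → Fin (M + 1) × Fin (2 ^ M)) :
    IsNetwork (chainGraph (fun v : Fin n => chainLoc (D / 2) (2 ^ M) (D % 2) v) (blockLinks p))
      D := by
  have hL : 0 < D / 2 := by omega
  refine isNetwork_proximityGraph hD ?_ ?_ ?_ ?_
  · intro v
    have hb := chainPos_bounds (blockLinks p) (chainLoc (D / 2) (2 ^ M) (D % 2) v)
    by_cases h : v.val < D / 2 * (2 ^ M + 1)
    · have hl : (chainLoc (D / 2) (2 ^ M) (D % 2) v).1 < D / 2 := by
        rw [chainLoc, if_pos h]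
        exact Nat.div_lt_of_lt_mul (by rwa [mul_comm])
      dsimp only
      omega
    · by_cases he : D % 2 = 1
      · have hl : (chainLoc (D / 2) (2 ^ M) (D % 2) v).1 = D / 2 := by
          rw [chainLoc, if_neg h]
        dsimp only
        omega
      · have hl : chainLoc (D / 2) (2 ^ M) (D % 2) v = (D / 2, none) := by
          rw [chainLoc, if_neg h, if_neg fun hh => he hh.1]
        dsimp only
        rw [hl]
        simp only [chainPos]
        omega
  · intro h hh
    rcases Nat.even_or_odd' h with ⟨i, rfl | rfl⟩
    · rcases lt_or_ge i (D / 2) with hi | hi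
      · have := Nat.mul_lt_mul_of_pos_right hi (2 ^ M).succ_pos
        refine ⟨⟨i * (2 ^ M + 1), by simp only [Nat.succ_eq_add_one] at this; omega⟩, ?_⟩
        dsimp only
        rw [chainLoc_gateway hi]
        simp only [chainPos]
        omega
      · obtain rfl : i = D / 2 := by omega
        refine ⟨⟨D / 2 * (2 ^ M + 1), by omega⟩, ?_⟩
        dsimp only
        rw [chainLoc_end]
        simp only [chainPos]
        omega
    · have hi : i < D / 2 := by omega
      -- The block around `b` contains `b`, so this member is linked and sits at `4 * i + 2`.
      have hx := (p ⟨i, hi⟩).2.isLt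
      have := add_lt_mul_succ hi hx
      refine ⟨⟨i * (2 ^ M + 1) + ((p ⟨i, hi⟩).2 + 1), by omega⟩, ?_⟩
      dsimp only
      rw [chainLoc_member hi hx]
      have : blockLinks p i (p ⟨i, hi⟩).2 := ⟨hi, rfl⟩
      simp only [chainPos, if_pos this]
      omega
  · by_cases he : D % 2 = 1
    · refine ⟨⟨D / 2 * (2 ^ M + 1) + 1, by omega⟩, ?_⟩
      have : chainLoc (D / 2) (2 ^ M) (D % 2) (D / 2 * (2 ^ M + 1) + 1) = (D / 2, some 0) := by
        rw [chainLoc, if_neg (by omega), if_pos ⟨he, by omega⟩]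
      dsimp only
      rw [this]
      have := four_mul_lt_chainPos (blockLinks p) (D / 2) 0
      omega
    · refine ⟨⟨D / 2 * (2 ^ M + 1), by omega⟩, ?_⟩
      dsimp only
      rw [chainLoc_end]
      simp only [chainPos]
      omega
  · have key : ∀ v : Fin n,
        chainPos (blockLinks p) (chainLoc (D / 2) (2 ^ M) (D % 2) v) = 0 → v.val = 0 := by
      intro v hv
      have hb := chainPos_bounds (blockLinks p) (chainLoc (D / 2) (2 ^ M) (D % 2) v)
      by_cases h : v.val < D / 2 * (2 ^ M + 1)
      · rw [chainLoc, if_pos h] at hv hb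
        split_ifs at hv hb with h0
        · have h1 := Nat.div_add_mod v.val (2 ^ M + 1)
          have h2 : v.val / (2 ^ M + 1) = 0 := by
            dsimp only at hb
            omega
          rw [h2, h0] at h1
          omega
        · have := four_mul_lt_chainPos (blockLinks p) (v.val / (2 ^ M + 1))
            (v.val % (2 ^ M + 1) - 1)
          omega
      · rw [chainLoc, if_neg h] at hb hv
        dsimp only at hb
        omega
    exact fun u v hu hv => Fin.ext ((key u hu).trans (key v hv).symm)

variable {M n C : ℕ}

/-- The truncated network, and with it the arrival time and the transmitters at level `i`, does not
depend on the block chosen there. -/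
theorem linksBelow_blockLinks_update (p : Fin L → Fin (M + 1) × Fin (2 ^ M)) (i : Fin L)
    (x : Fin (M + 1) × Fin (2 ^ M)) :
    linksBelow i (blockLinks (Function.update p i x)) = linksBelow i (blockLinks p) := by
  funext j y
  refine propext (and_congr_right fun hj => exists_congr fun h => ?_)
  rw [Function.update_of_ne fun he => hj.ne (congrArg Fin.val he)]

theorem blockLinks_update_self (p : Fin L → Fin (M + 1) × Fin (2 ^ M)) (i : Fin L)
    (x : Fin (M + 1) × Fin (2 ^ M)) (y : ℕ) :
    blockLinks (Function.update p i x) i y ↔ y / 2 ^ x.1.val = x.2.val / 2 ^ x.1.val := by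
  simp [blockLinks]

variable [NeZero C] (A : Algorithm n C) (loc : Fin n → ℕ × Option ℕ) (source : Fin n)
  (ω : Fin n → A.Seed)

open Classical in
-- With the other blocks fixed, the window of `m` rounds and its transmitter sets are fixed too. A
-- union bound over the window leaves at least half of the blocks unisolated.
theorem card_le_two_mul_card_delayed (i : Fin L) :
    Fintype.card (Fin L → Fin (M + 1) × Fin (2 ^ M)) ≤
      2 * (Finset.univ.filter fun p : Fin L → Fin (M + 1) × Fin (2 ^ M) =>
        Delayed loc A source ω ((M + 1) / 4) (blockLinks p) i).card := by
  refine card_pi_le_two_mul_card i _ fun p => ?_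
  set m := (M + 1) / 4 with hm
  -- If level `i` is never reached, `s` is `0`; the count only uses that the window has `m` rounds.
  set s := sInf {r | Reached loc A source ω (linksBelow i (blockLinks p)) i r} with hs
  set T := transmitters loc A source ω (linksBelow i (blockLinks p)) i with hT
  have hiff : ∀ x : Fin (M + 1) × Fin (2 ^ M),
      Delayed loc A source ω m (blockLinks (Function.update p i x)) i ↔
        ¬ ∃ r ∈ Finset.Ico s (s + m), Isolates (T r) x.1 x.2 := by
    intro x
    simp only [Delayed, linksBelow_blockLinks_update, blockLinks_update_self, ← hs, ← hT, Isolates,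
      Finset.mem_Ico, not_exists, not_and, and_imp]
  simp only [hiff]
  have hsplit := Finset.card_filter_add_card_filter_not (s := Finset.univ)
    fun x : Fin (M + 1) × Fin (2 ^ M) => ∃ r ∈ Finset.Ico s (s + m), Isolates (T r) x.1 x.2
  have hbad : (Finset.univ.filter fun x : Fin (M + 1) × Fin (2 ^ M) =>
      ∃ r ∈ Finset.Ico s (s + m), Isolates (T r) x.1 x.2).card ≤ m * (2 * 2 ^ M) := by
    have hsub : (Finset.univ.filter fun x : Fin (M + 1) × Fin (2 ^ M) =>
        ∃ r ∈ Finset.Ico s (s + m), Isolates (T r) x.1 x.2) =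
        (Finset.Ico s (s + m)).biUnion fun r =>
          Finset.univ.filter fun x : Fin (M + 1) × Fin (2 ^ M) => Isolates (T r) x.1 x.2 := by
      ext x
      simp
    rw [hsub]
    refine (Finset.card_biUnion_le_card_mul _ _ _ fun r _ => card_isolates_le (T r) M).trans ?_
    rw [Nat.card_Ico, Nat.add_sub_cancel_left]
  rw [Finset.card_univ] at hsplit
  have hP : Fintype.card (Fin (M + 1) × Fin (2 ^ M)) = (M + 1) * 2 ^ M := by simp
  -- The choice `m = (M + 1) / 4` keeps the bad pairs, at most `m * (2 * 2 ^ M)`, within half of all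
  -- pairs.
  have : 4 * m * 2 ^ M ≤ (M + 1) * 2 ^ M := Nat.mul_le_mul_right _ (by omega)
  rw [hP] at hsplit ⊢
  have h4 : 4 * m * 2 ^ M = 2 * (m * (2 * 2 ^ M)) := by ring
  omega

variable {loc source}

/-- For fixed seeds, double counting of delayed levels over all networks: each level is delayed in
at least half of them. -/
theorem card_mul_le_sum_broadcastTime (hs : (loc source).1 = 0) (hlast : ∃ v, (loc v).1 = L) :
    ((((M + 1) / 4 + 1) * L * Fintype.card (Fin L → Fin (M + 1) × Fin (2 ^ M)) : ℕ) : ℝ≥0∞) ≤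
      2 * ∑ p : Fin L → Fin (M + 1) × Fin (2 ^ M),
        (A.broadcastTime (chainGraph loc (blockLinks p)) source ω : ℝ≥0∞) := by
  classical
  set m := (M + 1) / 4 with hm
  let N : (Fin L → Fin (M + 1) × Fin (2 ^ M)) → ℕ := fun p =>
    ((Finset.range L).filter fun j => Delayed loc A source ω m (blockLinks p) j).card
  have htime : ∀ p, (((m + 1) * N p : ℕ) : ℝ≥0∞) ≤
      (A.broadcastTime (chainGraph loc (blockLinks p)) source ω : ℝ≥0∞) := by
    intro p
    rw [← ENat.toENNReal_coe, ENat.toENNReal_le, le_broadcastTime_iff]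
    intro r hr
    obtain ⟨v, hv⟩ := hlast
    exact_mod_cast card_delayed_mul_le m hs L ⟨v, hv.ge, hr v⟩
  have hsum : (m + 1) * L * Fintype.card (Fin L → Fin (M + 1) × Fin (2 ^ M)) ≤
      2 * ∑ p, (m + 1) * N p := by
    have hN : ∑ p, N p = ∑ i : Fin L,
        (Finset.univ.filter fun p : Fin L → Fin (M + 1) × Fin (2 ^ M) =>
          Delayed loc A source ω m (blockLinks p) i).card := by
      simp only [N, Finset.card_filter]
      rw [Finset.sum_comm, ← Fin.sum_univ_eq_sum_range fun j =>
        ∑ p : Fin L → Fin (M + 1) × Fin (2 ^ M),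
          if Delayed loc A source ω m (blockLinks p) j then 1 else 0]
    have hcard : L * Fintype.card (Fin L → Fin (M + 1) × Fin (2 ^ M)) ≤ 2 * ∑ p, N p := by
      rw [hN, Finset.mul_sum]
      calc L * Fintype.card (Fin L → Fin (M + 1) × Fin (2 ^ M))
          = ∑ _i : Fin L, Fintype.card (Fin L → Fin (M + 1) × Fin (2 ^ M)) := by
            rw [Finset.sum_const, Finset.card_univ, Fintype.card_fin, smul_eq_mul]
        _ ≤ _ := Finset.sum_le_sum fun i _ => card_le_two_mul_card_delayed A loc source ω i
    rw [← Finset.mul_sum]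
    calc _ = (m + 1) * (L * Fintype.card (Fin L → Fin (M + 1) × Fin (2 ^ M))) := by ring
      _ ≤ (m + 1) * (2 * ∑ p, N p) := Nat.mul_le_mul_left _ hcard
      _ = _ := by ring
  calc _ ≤ ((2 * ∑ p, (m + 1) * N p : ℕ) : ℝ≥0∞) := by exact_mod_cast hsum
    _ = 2 * ∑ p, (((m + 1) * N p : ℕ) : ℝ≥0∞) := by push_cast; rfl
    _ ≤ _ := by gcongr with p; exact htime p

/-- If every network were fast in expectation, so would be their average, against the pointwise
bound integrated over the seeds. -/
theorem exists_expectedTime_ge (hs : (loc source).1 = 0) (hlast : ∃ v, (loc v).1 = L) (M : ℕ) :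
    ∃ p : Fin L → Fin (M + 1) × Fin (2 ^ M),
      ((((M + 1) / 4 + 1) * L : ℕ) : ℝ≥0∞) ≤
        2 * A.expectedTime (chainGraph loc (blockLinks p)) source := by
  by_contra! h
  have hlt := ENNReal.sum_lt_sum_of_nonempty
    (s := (Finset.univ : Finset (Fin L → Fin (M + 1) × Fin (2 ^ M))))
    Finset.univ_nonempty fun p _ => h p
  refine hlt.not_ge ?_
  rw [Finset.sum_const, Finset.card_univ, nsmul_eq_mul, ← Finset.mul_sum]
  unfold Algorithm.expectedTime
  rw [← lintegral_finsetSum _ fun p _ => measurable_coe_broadcastTime A _ source,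
    ← lintegral_const_mul _
      (Finset.measurable_fun_sum _ fun p _ => measurable_coe_broadcastTime A _ source)]
  refine le_trans (le_of_eq ?_) (lintegral_mono fun ω =>
    card_mul_le_sum_broadcastTime (M := M) A ω hs hlast)
  rw [lintegral_const, measure_univ, mul_one]
  push_cast
  ring

end HardInstances

/-! ### Choice of parameters and constants -/

section Parameters

/-- The size `2 ^ M` of the cliques: `D / 2` of them fit into a network of size `n`. -/
theorem exists_clique_size {n D : ℕ} (hD : 2 ≤ D) (hn : D + 1 ≤ n) :
    ∃ M, D / 2 * (2 ^ M + 1) + 1 + D % 2 ≤ n ∧ n ≤ D * 2 ^ (M + 1) := by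
  have hL : 0 < D / 2 := by omega
  have h2 : 2 ≤ (n - 1 - D % 2) / (D / 2) := (Nat.le_div_iff_mul_le hL).2 (by omega)
  -- The number of members available per clique after setting aside its gateway, the last gateway
  -- and, for odd `D`, one more node; `2 ^ M` is the largest power of two below or at `q`.
  set q := (n - 1 - D % 2) / (D / 2) - 1 with hq
  have h1 : 2 ^ Nat.log 2 q ≤ q := Nat.pow_log_le_self 2 (by omega)
  have h3 : q < 2 ^ (Nat.log 2 q + 1) := Nat.lt_pow_succ_log_self (by norm_num) q
  refine ⟨Nat.log 2 q, ?_, ?_⟩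
  · have h4 : 2 ^ Nat.log 2 q + 1 ≤ (n - 1 - D % 2) / (D / 2) := by omega
    rw [Nat.le_div_iff_mul_le hL, mul_comm] at h4
    omega
  · have h4 : (n - 1 - D % 2) / (D / 2) < 2 ^ (Nat.log 2 q + 1) + 1 := by omega
    rw [Nat.div_lt_iff_lt_mul hL] at h4
    set X := 2 ^ (Nat.log 2 q + 1) with hX
    have hX2 : 1 ≤ X := Nat.one_le_two_pow
    have h5 : D * X = D / 2 * X + D / 2 * X + D % 2 * X := by
      rw [← add_mul, ← add_mul]
      congr 1
      omega
    have h6 : D / 2 ≤ D / 2 * X := Nat.le_mul_of_pos_right _ hX2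
    have h7 : D % 2 ≤ D % 2 * X := Nat.le_mul_of_pos_right _ hX2
    have h8 : (X + 1) * (D / 2) = D / 2 * X + D / 2 := by ring
    omega

theorem log_div_le {n D M : ℕ} (hD : 2 ≤ D) (hn : D + 1 ≤ n) (h : n ≤ D * 2 ^ (M + 1)) :
    Real.log ((n : ℝ) / D) ≤ M + 1 := by
  have hD0 : (0 : ℝ) < D := by exact_mod_cast (by omega : 0 < D)
  have hn0 : (0 : ℝ) < n := by exact_mod_cast (by omega : 0 < n)
  have h' : (n : ℝ) ≤ D * 2 ^ (M + 1) := by exact_mod_cast h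
  calc Real.log ((n : ℝ) / D) ≤ Real.log (2 ^ (M + 1)) :=
        Real.log_le_log (by positivity) ((div_le_iff₀' hD0).2 h')
    _ = (M + 1) * Real.log 2 := by rw [Real.log_pow]; push_cast; rfl
    _ ≤ (M + 1) * 1 := by
        gcongr
        exact (Real.log_two_lt_d9.le).trans (by norm_num)
    _ = M + 1 := mul_one _

theorem exists_hard_network {n C D : ℕ} [NeZero C] (A : Algorithm n C) (hD : 2 ≤ D)
    (hn : D + 1 ≤ n) :
    ∃ (G : SimpleGraph (Fin n)) (source : Fin n), IsUnitDiskGraph G ∧ IsNetwork G D ∧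
      ENNReal.ofReal (1 / 24 * (D * Real.log ((n : ℝ) / D))) ≤ A.expectedTime G source := by
  obtain ⟨M, hM, hM'⟩ := exists_clique_size hD hn
  have hL : 0 < D / 2 := by omega
  obtain ⟨p, hp⟩ := exists_expectedTime_ge A
    (loc := fun v : Fin n => chainLoc (D / 2) (2 ^ M) (D % 2) v) (source := ⟨0, by omega⟩)
    (L := D / 2) (chainLoc_fst_zero hL)
    ⟨⟨D / 2 * (2 ^ M + 1), by omega⟩, by dsimp only; rw [chainLoc_end]⟩ M
  refine ⟨_, ⟨0, by omega⟩, isUnitDiskGraph_proximityGraph _, isNetwork_blockLinks hD hM p, ?_⟩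
  refine (ENNReal.mul_le_mul_iff_right two_ne_zero ENNReal.ofNat_ne_top).1 (le_trans ?_ hp)
  rw [← ENNReal.ofReal_ofNat, ← ENNReal.ofReal_mul (by norm_num), ← ENNReal.ofReal_natCast]
  refine ENNReal.ofReal_le_ofReal ?_
  have hlog := log_div_le hD hn hM'
  -- The constant is `24 = 2 * 3 * 4`: averaging loses 2, rounding `D / 2` loses 3, and the window
  -- length loses 4.
  have h1 : (D : ℝ) ≤ 3 * (D / 2 : ℕ) := by exact_mod_cast (by omega : D ≤ 3 * (D / 2))
  have h2 : (M : ℝ) + 1 ≤ 4 * (((M + 1) / 4 : ℕ) + 1) := by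
    exact_mod_cast (by omega : M + 1 ≤ 4 * ((M + 1) / 4 + 1))
  have h3 : (D : ℝ) * Real.log ((n : ℝ) / D) ≤
      3 * (D / 2 : ℕ) * (4 * (((M + 1) / 4 : ℕ) + 1)) :=
    (mul_le_mul_of_nonneg_left (hlog.trans h2) (Nat.cast_nonneg D)).trans
      (mul_le_mul_of_nonneg_right h1 (by positivity))
  push_cast at h3 ⊢
  linarith

end Parameters

end RadioNetwork

theorem mainTheorem11 :
    ∃ c : ℝ, 0 < c ∧ ∀ A : (n C D : ℕ) → [NeZero C] → RadioNetwork.Algorithm.{u} n C,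
      (∀ (n C D : ℕ) [NeZero C], 2 ≤ D → D + 1 ≤ n →
        ∃ (G : SimpleGraph (Fin n)) (source : Fin n),
          RadioNetwork.IsUnitDiskGraph G ∧ RadioNetwork.IsNetwork G D ∧
          ENNReal.ofReal (c * (D * Real.log ((n : ℝ) / D))) ≤
            (A n C D).expectedTime G source) ∧
      (∀ f : ℕ → ℕ → ℕ → ℝ, RadioNetwork.SolvesBroadcastIn A f →
        ∀ n C D : ℕ, 1 ≤ C → 2 ≤ D → D + 1 ≤ n →
          c * (D * Real.log ((n : ℝ) / D)) ≤ f n C D) := by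
  refine ⟨1 / 24, by norm_num, fun A =>
    ⟨fun n C D _ hD hn => RadioNetwork.exists_hard_network (A n C D) hD hn, ?_⟩⟩
  intro f hf n C D hC hD hn
  have : NeZero C := ⟨by omega⟩
  obtain ⟨G, source, -, hG, hle⟩ := RadioNetwork.exists_hard_network (A n C D) hD hn
  have hD0 : (0 : ℝ) < D := by exact_mod_cast (by omega : 0 < D)
  have hlog : 0 < Real.log ((n : ℝ) / D) :=
    Real.log_pos ((one_lt_div hD0).2 (by exact_mod_cast hn))
  -- `ENNReal.ofReal` truncates negative values, so positivity of the bound is needed to recover the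
  -- real inequality.
  rcases ENNReal.ofReal_le_ofReal_iff'.1 (hle.trans (hf n C D G source hD hG)) with h | h
  · exact h
  · exact absurd h (not_le.2 (by positivity))
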